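/- All systems are finite-dimensional, and a quantum channel $\mathcal N$ from $A$ to $B$ (with $d_A\ge 1$) is a completely positive trace-preserving linear map from operators on $\mathbb C^{d_A}$ to operators on $\mathbb C^{d_B}$. An isometry $V:\mathbb C^{d_A}\to\mathbb C^{d_B}\otimes\mathbb C^{d}$ with $\mathcal N(\rho)=\operatorname{tr}_E(V\rho V^\dagger)$ for all $\rho$ realises $\mathcal N$ with an environment $E$ of dimension $d$, and $\mathcal N^C(\rho)=\operatorname{tr}_B(V\rho V^\dagger)$ is then a complementary channel of $\mathcal N$. The environment dimension $d_E$ of $\mathcal N$ is the smallest $d$ for which such a $V$ exists. The channel $\mathcal N$ is degradable if $\mathcal N^C=\mathcal D\circ\mathcal N$ for some complementary channel $\mathcal N^C$ of $\mathcal N$ and some channel $\mathcal D$, and anti-degradable if $\mathcal N=\mathcal D\circ\mathcal N^C$ for some such $\mathcal N^C$ and $\mathcal D$. Its Choi state is $\rho_{\mathcal N}=\frac1{d_A}\sum_{i,j}|i\rangle\langle j|\otimes\mathcal N(|i\rangle\langle j|)$, and $\lambda_{\max}$ denotes the largest eigenvalue. (1) If $\mathcal N$ is a degradable channel with qubit output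 ($d_B=2$), then $d_E\le 2$ and $\lambda_{\max}(\operatorname{tr}_A\rho_{\mathcal N})\le\lambda_{\max}(\rho_{\mathcal N})$. (2) If $\mathcal N$ is an anti-degradable channel, with arbitrary output dimension, that can be realised with a qubit environment ($d=2$), then its output has rank at most $2$, that is, $\operatorname{rank}(\operatorname{tr}_A\rho_{\mathcal N})\le 2$, and $\lambda_{\max}(\rho_{\mathcal N})\le\lambda_{\max}(\operatorname{tr}_A\rho_{\mathcal N})$. -/

import Mathlib

open scoped Matrix ComplexOrder

namespace QuantumChannel

/-- Linear maps from operators on `ℂ^A` to operators on `ℂ^B`. -/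
abbrev SuperOp (A B : Type*) : Type _ := Matrix A A ℂ →ₗ[ℂ] Matrix B B ℂ

section PartialTrace

variable {X Y : Type*}

/-- Partial trace over the first tensor factor of an operator on `ℂ^X ⊗ ℂ^Y`. -/
def traceFst [Fintype X] : SuperOp (X × Y) Y where
  toFun M := Matrix.of fun y y' => ∑ x, M (x, y) (x, y')
  map_add' M N := by ext; simp [Finset.sum_add_distrib]
  map_smul' c M := by ext; simp [Finset.mul_sum]

/-- Partial trace over the second tensor factor of an operator on `ℂ^X ⊗ ℂ^Y`. -/
def traceSnd [Fintype Y] : SuperOp (X × Y) X where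
  toFun M := Matrix.of fun x x' => ∑ y, M (x, y) (x', y)
  map_add' M N := by ext; simp [Finset.sum_add_distrib]
  map_smul' c M := by ext; simp [Finset.mul_sum]

end PartialTrace

/-- The amplification `id_k ⊗ Φ`, acting on operators on `ℂ^k ⊗ ℂ^A`, that is, on
`k × k` block matrices with blocks in `Matrix A A ℂ`. -/
def amplify {A B : Type*} (Φ : SuperOp A B) (k : ℕ) (M : Matrix (Fin k × A) (Fin k × A) ℂ) :
    Matrix (Fin k × B) (Fin k × B) ℂ :=
  Matrix.of fun p q => Φ (Matrix.of fun a a' => M (p.1, a) (q.1, a')) p.2 q.2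

/-- A quantum channel: a completely positive trace-preserving linear map. -/
structure IsChannel {A B : Type*} [Fintype A] [Fintype B] (Φ : SuperOp A B) : Prop where
  completelyPositive : ∀ (k : ℕ) (M : Matrix (Fin k × A) (Fin k × A) ℂ),
    M.PosSemidef → (amplify Φ k M).PosSemidef
  tracePreserving : ∀ M : Matrix A A ℂ, (Φ M).trace = M.trace

section Dilation

variable {A B E : Type*} [Fintype A] [DecidableEq A] [Fintype B] [Fintype E]

/-- `V : ℂ^A → ℂ^B ⊗ ℂ^E` is a Stinespring dilation of `N` with environment `ℂ^E`:
`V` is an isometry and `N(ρ) = tr_E (V ρ V†)`. -/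
def IsDilation (V : Matrix (B × E) A ℂ) (N : SuperOp A B) : Prop :=
  Vᴴ * V = 1 ∧ ∀ ρ : Matrix A A ℂ, N ρ = traceSnd (V * ρ * Vᴴ)

/-- `NC` is a complementary channel of `N`: for some dilation `V` of `N` with environment
`ℂ^E`, it maps `ρ` to the state `tr_B (V ρ V†)` of the environment. -/
def IsComplementary (N : SuperOp A B) (NC : SuperOp A E) : Prop :=
  ∃ V : Matrix (B × E) A ℂ, IsDilation V N ∧ ∀ ρ : Matrix A A ℂ, NC ρ = traceFst (V * ρ * Vᴴ)

/-- `N` is degradable: some channel `D` applied to the output of `N` gives a complementary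
channel of `N`. -/
def IsDegradable (N : SuperOp A B) : Prop :=
  ∃ (d : ℕ) (NC : SuperOp A (Fin d)), IsComplementary N NC ∧
    ∃ D : SuperOp B (Fin d), IsChannel D ∧ NC = D ∘ₗ N

/-- `N` is anti-degradable: some channel `D` applied to the output of a complementary channel
of `N` gives `N`. -/
def IsAntiDegradable (N : SuperOp A B) : Prop :=
  ∃ (d : ℕ) (NC : SuperOp A (Fin d)), IsComplementary N NC ∧
    ∃ D : SuperOp (Fin d) B, IsChannel D ∧ N = D ∘ₗ NC

/-- `N` can be realised with an environment of dimension `d`. -/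
def HasEnvironment (N : SuperOp A B) (d : ℕ) : Prop :=
  ∃ V : Matrix (B × Fin d) A ℂ, IsDilation V N

/-- The environment dimension `d_E` of `N`: the smallest dimension of an environment with which
`N` can be realised (`⊤` if there is none). -/
noncomputable def envDim (N : SuperOp A B) : ℕ∞ :=
  ⨅ (d : ℕ) (_ : HasEnvironment N d), (d : ℕ∞)

end Dilation

/-- The Choi-Jamiolkowski state `(1/d_A) ∑ i j, |i⟩⟨j| ⊗ N(|i⟩⟨j|)` of `N`. -/
noncomputable def choi {A B : Type*} [Fintype A] [DecidableEq A] (N : SuperOp A B) :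
    Matrix (A × B) (A × B) ℂ :=
  (Fintype.card A : ℂ)⁻¹ •
    ∑ i, ∑ j, Matrix.kronecker (Matrix.single i j (1 : ℂ)) (N (Matrix.single i j 1))

/-- The largest real eigenvalue of a square matrix. -/
noncomputable def lambdaMax {n : Type*} [Fintype n] [DecidableEq n] (M : Matrix n n ℂ) : ℝ :=
  sSup (spectrum ℝ M)

/-- For Hermitian matrices of positive size the supremum in `lambdaMax` is attained. -/
theorem isGreatest_lambdaMax {n : Type*} [Fintype n] [DecidableEq n] [Nonempty n]
    {M : Matrix n n ℂ} (hM : M.IsHermitian) : IsGreatest (spectrum ℝ M) (lambdaMax M) := by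
  have h : spectrum ℝ M = Set.range hM.eigenvalues := hM.spectrum_real_eq_range_eigenvalues
  have hfin : (spectrum ℝ M).Finite := h ▸ Set.finite_range _
  have hne : (spectrum ℝ M).Nonempty := h ▸ Set.range_nonempty _
  exact ⟨hne.csSup_mem hfin, fun x hx => le_csSup hfin.bddAbove hx⟩

end QuantumChannel

open QuantumChannel

/-!
Fix a dilation `V` and write `K a` for the vector `V |a⟩` as a `B × E` matrix. The channel sends
`|a⟩⟨b|` to `K a * (K b)ᴴ` and the complementary channel sends it to `(K a)ᵀ * ((K b)ᵀ)ᴴ`. If the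
channel is degradable by `D` and its output on the identity has rank at most two, two things
follow.

* Rank (`rank_environment_le_two`). If some pure input `ψ` has an output of rank two, the output
  of the identity is at most a multiple of it; applying `D`, the environment state of `ψ` supports
  the whole environment, and its rank is that of the output. Otherwise every combination of the
  `K a` has rank at most one, so they share a row or a column space, and the environment state is,
  up to normalization, always the same pure state.
* Purity (`purity_output_le_purity_environment`). A traceless Hermitian `X` of rank two has
  eigenvalues `t, -t`, and therefore `D` cannot increase its Hilbert-Schmidt norm
  (`trace_map_mul_map_self_re_le`). Applied to differences of the outputs of two pure states,
  for which output and environment are equally pure, this shows that the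
  outputs of pure states overlap at most as much as the environments. Summing over a basis, the environment of the maximally mixed state is at
  least as pure as its output.

The Choi state and the environment of the maximally mixed state are marginals of one pure state,
so they have equal rank and purity (`IsDilation.rank_choi`, `IsDilation.purity_choi`). For a state
of rank at most two, purity controls the largest eigenvalue
(`lambdaMax_le_lambdaMax_of_purity_le`), and a factorization of the Choi matrix of rank two is a
dilation with qubit environment (`IsChannel.hasEnvironment_of_rank_choi_le`). Anti-degradability
is the same situation with the `K a` transposed.
-/

namespace QuantumChannel

open Matrix

/-! ### Purity and the largest eigenvalue -/

section Spectral

variable {n : Type*} [Fintype n] [DecidableEq n]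

theorem trace_re_eq_sum_eigenvalues {X : Matrix n n ℂ} (hX : X.IsHermitian) :
    X.trace.re = ∑ i, hX.eigenvalues i := by
  rw [hX.trace_eq_sum_eigenvalues]
  simp

theorem trace_mul_self_re_eq_sum_sq_eigenvalues {X : Matrix n n ℂ} (hX : X.IsHermitian) :
    (X * X).trace.re = ∑ i, hX.eigenvalues i ^ 2 := by
  have h : X * X = Unitary.conjStarAlgAut ℂ _ hX.eigenvectorUnitary
      (diagonal fun i => ((hX.eigenvalues i ^ 2 : ℝ) : ℂ)) := by
    conv_lhs => rw [hX.spectral_theorem, ← map_mul, diagonal_mul_diagonal]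
    congr 2
    ext i
    simp [sq]
  rw [h, Unitary.conjStarAlgAut_apply, trace_mul_cycle, Unitary.coe_star_mul_self, one_mul,
    trace_diagonal]
  simp [-Complex.ofReal_pow]

/-- A positive semidefinite matrix of rank at most `k` has a square factorization through
`ℂ^k`. -/
theorem exists_eq_mul_conjTranspose_of_rank_le {P : Matrix n n ℂ} (hP : P.PosSemidef) {k : ℕ}
    (hk : P.rank ≤ k) : ∃ W : Matrix n (Fin k) ℂ, P = W * Wᴴ := by
  have hcard : Fintype.card {i // hP.1.eigenvalues i ≠ 0} ≤ Fintype.card (Fin k) := by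
    rw [← hP.1.rank_eq_card_non_zero_eigs, Fintype.card_fin]
    exact hk
  obtain ⟨f⟩ := Function.Embedding.nonempty_of_card_le hcard
  let T : Matrix n (Fin k) ℂ := Matrix.of fun i j =>
    if h : hP.1.eigenvalues i ≠ 0 then
      if f ⟨i, h⟩ = j then (Real.sqrt (hP.1.eigenvalues i) : ℂ) else 0
    else 0
  have hT : T * Tᴴ = diagonal (RCLike.ofReal ∘ hP.1.eigenvalues) := by
    ext i i'
    simp only [T, mul_apply, conjTranspose_apply, of_apply, diagonal_apply, Function.comp_apply]
    by_cases h : hP.1.eigenvalues i = 0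
    · simp [h]
    by_cases h' : hP.1.eigenvalues i' = 0
    · have : i ≠ i' := by rintro rfl; exact h h'
      simp [h', this]
    by_cases hii : i = i'
    · subst hii
      have := Real.mul_self_sqrt (hP.eigenvalues_nonneg i)
      simp [h, ← Complex.ofReal_mul, this]
    · have : f ⟨i', h'⟩ ≠ f ⟨i, h⟩ := fun he => hii (by simpa using (f.injective he).symm)
      simp [h, h', hii, this]
  refine ⟨(hP.1.eigenvectorUnitary : Matrix n n ℂ) * T, ?_⟩
  conv_lhs => rw [hP.1.spectral_theorem, Unitary.conjStarAlgAut_apply, ← hT]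
  rw [conjTranspose_mul, star_eq_conjTranspose]
  simp only [Matrix.mul_assoc]

theorem trace_mul_re_nonneg {P Q : Matrix n n ℂ} (hP : P.PosSemidef) (hQ : Q.PosSemidef) :
    0 ≤ (P * Q).trace.re := by
  obtain ⟨W, rfl⟩ := exists_eq_mul_conjTranspose_of_rank_le hP P.rank_le_card_width
  rw [Matrix.mul_assoc, trace_mul_comm]
  exact (Complex.le_def.1 (hQ.conjTranspose_mul_mul_same W).trace_nonneg).1

theorem trace_mul_self_re_le_sq {P : Matrix n n ℂ} (hP : P.PosSemidef) :
    (P * P).trace.re ≤ P.trace.re ^ 2 := by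
  rw [trace_mul_self_re_eq_sum_sq_eigenvalues hP.1, trace_re_eq_sum_eigenvalues hP.1]
  exact Finset.sum_sq_le_sq_sum_of_nonneg fun i _ => hP.eigenvalues_nonneg i

/-- A traceless Hermitian matrix of rank at most two has eigenvalues `t, -t`, so it is a
difference of positive semidefinite matrices of trace `t` with `2 t ^ 2` at most the trace of its
square. -/
theorem exists_posSemidef_sub_of_trace_eq_zero {X : Matrix n n ℂ} (hX : X.IsHermitian)
    (h0 : X.trace = 0) (hr : X.rank ≤ 2) :
    ∃ (R S : Matrix n n ℂ) (t : ℝ), R.PosSemidef ∧ S.PosSemidef ∧ X = R - S ∧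
      R.trace.re = t ∧ S.trace.re = t ∧ 2 * t ^ 2 ≤ (X * X).trace.re := by
  set φ := Unitary.conjStarAlgAut ℂ _ hX.eigenvectorUnitary with hφ
  have hpsd : ∀ g : n → ℝ, (∀ i, 0 ≤ g i) →
      (φ (diagonal fun i => (g i : ℂ))).PosSemidef := by
    intro g hg
    rw [hφ, Unitary.conjStarAlgAut_apply, star_eq_conjTranspose]
    refine PosSemidef.mul_mul_conjTranspose_same (PosSemidef.diagonal fun i => ?_) _
    simpa using hg i
  have htr : ∀ g : n → ℝ, (φ (diagonal fun i => (g i : ℂ))).trace.re = ∑ i, g i := by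
    intro g
    rw [hφ, Unitary.conjStarAlgAut_apply, trace_mul_cycle, Unitary.coe_star_mul_self, one_mul,
      trace_diagonal]
    simp
  have hsum : ∑ i, hX.eigenvalues i = 0 := by
    rw [← trace_re_eq_sum_eigenvalues hX, h0, Complex.zero_re]
  have hdiff : ∀ x : ℝ, max x 0 - max (-x) 0 = x := fun x => by
    rcases le_total x 0 with h | h <;> simp [h]
  have habs : ∀ x : ℝ, max x 0 + max (-x) 0 = |x| := fun x => by
    rcases le_total x 0 with h | h <;> simp [h, abs_of_nonneg, abs_of_nonpos]
  have hts : ∑ i, max (-hX.eigenvalues i) 0 = ∑ i, max (hX.eigenvalues i) 0 := by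
    have : ∑ i, (max (hX.eigenvalues i) 0 - max (-hX.eigenvalues i) 0) = 0 := by
      simp only [hdiff, hsum]
    rw [Finset.sum_sub_distrib] at this
    linarith
  refine ⟨φ (diagonal fun i => (max (hX.eigenvalues i) 0 : ℝ)),
    φ (diagonal fun i => (max (-hX.eigenvalues i) 0 : ℝ)), ∑ i, max (hX.eigenvalues i) 0,
    hpsd _ fun i => le_max_right _ _, hpsd _ fun i => le_max_right _ _, ?_, htr _,
    (htr _).trans hts, ?_⟩
  · rw [← map_sub, diagonal_sub]
    conv_lhs => rw [hX.spectral_theorem]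
    congr 2
    ext i
    simp only [Function.comp_apply]
    rw [← Complex.ofReal_sub, hdiff]
    rfl
  · rw [trace_mul_self_re_eq_sum_sq_eigenvalues hX]
    have h2 : 2 * ∑ i, max (hX.eigenvalues i) 0 = ∑ i, |hX.eigenvalues i| := by
      simp only [← habs, Finset.sum_add_distrib, hts]
      ring
    -- Cauchy-Schwarz over the at most two indices with a nonzero eigenvalue
    let s : Finset n := Finset.univ.filter fun i => hX.eigenvalues i ≠ 0
    have hs : (s.card : ℝ) ≤ 2 := by
      have : s.card ≤ 2 := by
        rw [← Fintype.card_subtype, ← hX.rank_eq_card_non_zero_eigs]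
        exact hr
      exact_mod_cast this
    have h3 : ∑ i, |hX.eigenvalues i| = ∑ i ∈ s, |hX.eigenvalues i| := by
      refine (Finset.sum_subset (Finset.subset_univ s) fun i _ hi => ?_).symm
      simpa [s] using hi
    have h4 := sq_sum_le_card_mul_sum_sq (s := s) (f := fun i => |hX.eigenvalues i|)
    have h5 : ∑ i ∈ s, |hX.eigenvalues i| ^ 2 ≤ ∑ i, hX.eigenvalues i ^ 2 := by
      simp only [sq_abs]
      exact Finset.sum_le_sum_of_subset_of_nonneg (Finset.subset_univ s) fun i _ _ => sq_nonneg _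
    have h6 : 0 ≤ ∑ i ∈ s, |hX.eigenvalues i| ^ 2 := Finset.sum_nonneg fun i _ => sq_nonneg _
    rw [← h3, ← h2] at h4
    nlinarith

theorem lambdaMax_mem_range_eigenvalues [Nonempty n] {X : Matrix n n ℂ} (hX : X.IsHermitian) :
    ∃ i, hX.eigenvalues i = lambdaMax X := by
  have := (isGreatest_lambdaMax hX).1
  rwa [hX.spectrum_real_eq_range_eigenvalues] at this

theorem eigenvalues_le_lambdaMax [Nonempty n] {X : Matrix n n ℂ} (hX : X.IsHermitian) (i : n) :
    hX.eigenvalues i ≤ lambdaMax X :=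
  (isGreatest_lambdaMax hX).2 (hX.eigenvalues_mem_spectrum_real i)

/-- A state `ρ` of rank at most two has purity `x ^ 2 + (1 - x) ^ 2` for `x = lambdaMax ρ`; for an
arbitrary state the purity is at most `y ^ 2 + (1 - y) ^ 2` and at most `y`, for `y` its largest
eigenvalue. Hence a larger purity forces a larger `lambdaMax`. -/
theorem lambdaMax_le_lambdaMax_of_purity_le {m : Type*} [Fintype m] [DecidableEq m]
    {ρ : Matrix n n ℂ} {σ : Matrix m m ℂ} (hρ : ρ.PosSemidef) (hσ : σ.PosSemidef)
    (hρ1 : ρ.trace = 1) (hσ1 : σ.trace = 1) (hr : ρ.rank ≤ 2)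
    (h : (ρ * ρ).trace.re ≤ (σ * σ).trace.re) : lambdaMax ρ ≤ lambdaMax σ := by
  have hn : Nonempty n := by
    by_contra hn
    rw [not_nonempty_iff] at hn
    simp [trace] at hρ1
  have hm : Nonempty m := by
    by_contra hm
    rw [not_nonempty_iff] at hm
    simp [trace] at hσ1
  obtain ⟨i, hi⟩ := lambdaMax_mem_range_eigenvalues hρ.1
  obtain ⟨j, hj⟩ := lambdaMax_mem_range_eigenvalues hσ.1
  have hle := eigenvalues_le_lambdaMax hσ.1
  rw [trace_mul_self_re_eq_sum_sq_eigenvalues hρ.1,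
    trace_mul_self_re_eq_sum_sq_eigenvalues hσ.1] at h
  have eρ := trace_re_eq_sum_eigenvalues hρ.1
  have eσ := trace_re_eq_sum_eigenvalues hσ.1
  rw [hρ1, Complex.one_re] at eρ
  rw [hσ1, Complex.one_re] at eσ
  by_contra! hlt
  set x := lambdaMax ρ
  set y := lambdaMax σ
  have hy : 0 ≤ y := hj ▸ hσ.eigenvalues_nonneg j
  rw [← Finset.add_sum_erase _ _ (Finset.mem_univ i), hi] at eρ
  have hx2 : x ^ 2 + (1 - x) ^ 2 ≤ ∑ i, hρ.1.eigenvalues i ^ 2 := by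
    rw [← Finset.add_sum_erase _ _ (Finset.mem_univ i), hi]
    -- besides `x` there is at most one nonzero eigenvalue
    let s : Finset n := (Finset.univ.erase i).filter fun k => hρ.1.eigenvalues k ≠ 0
    have hs : (s.card : ℝ) ≤ 1 := by
      have hx0 : hρ.1.eigenvalues i ≠ 0 := by rw [hi]; linarith
      have h1 : insert i s ⊆ Finset.univ.filter fun k => hρ.1.eigenvalues k ≠ 0 := by
        intro k hk
        simp only [s, Finset.mem_insert, Finset.mem_filter, Finset.mem_erase] at hk
        simp only [Finset.mem_filter, Finset.mem_univ, true_and]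
        rcases hk with rfl | hk
        exacts [hx0, hk.2]
      have h2 := Finset.card_le_card h1
      rw [Finset.card_insert_of_notMem (by simp [s]), ← Fintype.card_subtype,
        ← hρ.1.rank_eq_card_non_zero_eigs] at h2
      have : s.card ≤ 1 := by omega
      exact_mod_cast this
    have h3 : ∑ k ∈ Finset.univ.erase i, hρ.1.eigenvalues k = ∑ k ∈ s, hρ.1.eigenvalues k := by
      refine (Finset.sum_subset (Finset.filter_subset _ _) fun k hk hks => ?_).symm
      by_contra h0
      exact hks (Finset.mem_filter.2 ⟨hk, h0⟩)
    have h4 := sq_sum_le_card_mul_sum_sq (s := s) (f := hρ.1.eigenvalues)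
    have h5 : ∑ k ∈ s, hρ.1.eigenvalues k ^ 2
        ≤ ∑ k ∈ Finset.univ.erase i, hρ.1.eigenvalues k ^ 2 :=
      Finset.sum_le_sum_of_subset_of_nonneg (Finset.filter_subset _ _) fun i _ _ => sq_nonneg _
    have h6 : 0 ≤ ∑ k ∈ s, hρ.1.eigenvalues k ^ 2 := Finset.sum_nonneg fun i _ => sq_nonneg _
    rw [← h3] at h4
    have h7 : ∑ k ∈ Finset.univ.erase i, hρ.1.eigenvalues k = 1 - x := by linarith
    rw [h7] at h4
    nlinarith
  have hy1 : ∑ j, hσ.1.eigenvalues j ^ 2 ≤ y := by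
    calc ∑ j, hσ.1.eigenvalues j ^ 2 ≤ ∑ j, y * hσ.1.eigenvalues j :=
          Finset.sum_le_sum fun k _ => by
            rw [sq]
            exact mul_le_mul_of_nonneg_right (hle k) (hσ.eigenvalues_nonneg k)
      _ = y := by rw [← Finset.mul_sum, ← eσ, mul_one]
  have hy2 : ∑ j, hσ.1.eigenvalues j ^ 2 ≤ y ^ 2 + (1 - y) ^ 2 := by
    rw [← Finset.add_sum_erase _ _ (Finset.mem_univ j), hj] at eσ ⊢
    have h7 : ∑ k ∈ Finset.univ.erase j, hσ.1.eigenvalues k = 1 - y := by linarith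
    rw [← h7]
    gcongr
    exact Finset.sum_sq_le_sq_sum_of_nonneg fun i _ => hσ.eigenvalues_nonneg i
  rcases le_total (1 / 2) y with hy3 | hy3
  · nlinarith
  · nlinarith [sq_nonneg (x - (1 - x))]

end Spectral

/-! ### Hilbert-Schmidt contractivity of positive maps -/

section Positive

theorem trace_sub_mul_sub_re {n : Type*} [Fintype n] (P Q : Matrix n n ℂ) :
    ((P - Q) * (P - Q)).trace.re =
      (P * P).trace.re + (Q * Q).trace.re - 2 * (P * Q).trace.re := by
  rw [sub_mul, mul_sub, mul_sub, trace_sub, trace_sub, trace_sub, trace_mul_comm Q P]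
  simp only [Complex.sub_re]
  ring

variable {B E : Type*} [Fintype B] [Fintype E] [DecidableEq B] [DecidableEq E]

/-- A positive trace-preserving map does not increase the Hilbert-Schmidt norm of a traceless
Hermitian matrix of rank at most two: such a matrix is `R - S` with `R`, `S` positive of equal
trace `t` and `2 t ^ 2 ≤ tr (R - S) ^ 2`, and the images of `R` and `S` have nonnegative overlap
and purity at most `t ^ 2`. -/
theorem trace_map_mul_map_self_re_le {D : SuperOp B E}
    (hpos : ∀ P : Matrix B B ℂ, P.PosSemidef → (D P).PosSemidef)
    (htr : ∀ P, (D P).trace = P.trace) {X : Matrix B B ℂ} (hX : X.IsHermitian)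
    (h0 : X.trace = 0) (hr : X.rank ≤ 2) :
    (D X * D X).trace.re ≤ (X * X).trace.re := by
  obtain ⟨R, S, t, hR, hS, rfl, hRt, hSt, ht⟩ := exists_posSemidef_sub_of_trace_eq_zero hX h0 hr
  have h1 := trace_mul_self_re_le_sq (hpos R hR)
  have h2 := trace_mul_self_re_le_sq (hpos S hS)
  have h3 := trace_mul_re_nonneg (hpos R hR) (hpos S hS)
  rw [htr, hRt] at h1
  rw [htr, hSt] at h2
  rw [map_sub, trace_sub_mul_sub_re]
  linarith

end Positive

/-! ### Kernel containment and domination -/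

section Kernel

variable {m n l : Type*} [Fintype n] [Fintype m]

theorem exists_eq_mul_of_ker_le [DecidableEq n] [DecidableEq m] {P : Matrix m n ℂ}
    {Q : Matrix l n ℂ} (h : ∀ x, P *ᵥ x = 0 → Q *ᵥ x = 0) :
    ∃ Z : Matrix l m ℂ, Q = Z * P := by
  have hker : LinearMap.ker P.mulVecLin ≤ LinearMap.ker Q.mulVecLin := fun x hx => by
    simpa using h x (by simpa using hx)
  let f : LinearMap.range P.mulVecLin →ₗ[ℂ] l → ℂ :=
    (Submodule.liftQ _ Q.mulVecLin hker) ∘ₗ (P.mulVecLin.quotKerEquivRange.symm : _ →ₗ[ℂ] _)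
  obtain ⟨g, hg⟩ := f.exists_extend
  refine ⟨LinearMap.toMatrix' g, ?_⟩
  apply Matrix.mulVec_injective
  funext x
  have h1 : g (P.mulVecLin x) = f ⟨P.mulVecLin x, LinearMap.mem_range_self _ x⟩ := by
    rw [← hg]; rfl
  have h2 : f ⟨P.mulVecLin x, LinearMap.mem_range_self _ x⟩ = Q.mulVecLin x := by
    simp only [f, LinearMap.comp_apply, LinearEquiv.coe_coe]
    have : (P.mulVecLin.quotKerEquivRange.symm) ⟨P.mulVecLin x, LinearMap.mem_range_self _ x⟩ =
        Submodule.Quotient.mk x := by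
      rw [LinearEquiv.symm_apply_eq]
      rfl
    rw [this]
    rfl
  rw [← Matrix.mulVec_mulVec, LinearMap.toMatrix'_mulVec]
  exact (h1.trans h2).symm

theorem rank_le_rank_of_ker_le [DecidableEq n] [DecidableEq m] {P : Matrix m n ℂ}
    {Q : Matrix l n ℂ} (h : ∀ x, P *ᵥ x = 0 → Q *ᵥ x = 0) : Q.rank ≤ P.rank := by
  obtain ⟨Z, rfl⟩ := exists_eq_mul_of_ker_le h
  exact rank_mul_le_right _ _

/-- Kernel containment `ker Pᴴ ⊆ ker Q` makes a positive multiple of `P Pᴴ` dominate the positive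
semidefinite matrix `Q`: if `Q = W Wᴴ` and `Wᴴ = Z Pᴴ`, then `Zᴴ Z` is at most its trace. -/
theorem exists_posSemidef_smul_sub [DecidableEq n] [DecidableEq m] {P : Matrix n m ℂ}
    {Q : Matrix n n ℂ} (hQ : Q.PosSemidef) (h : ∀ x, Pᴴ *ᵥ x = 0 → Q *ᵥ x = 0) :
    ∃ t : ℂ, (t • (P * Pᴴ) - Q).PosSemidef := by
  obtain ⟨W, rfl⟩ := exists_eq_mul_conjTranspose_of_rank_le hQ Q.rank_le_card_width
  obtain ⟨Z, hZ⟩ := exists_eq_mul_of_ker_le (P := Pᴴ) (Q := Wᴴ) fun x hx => by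
    simpa [self_mul_conjTranspose_mulVec_eq_zero] using h x hx
  have hG : (Zᴴ * Z).PosSemidef := posSemidef_conjTranspose_mul_self Z
  have hdom : ((Zᴴ * Z).trace • (1 : Matrix m m ℂ) - Zᴴ * Z).PosSemidef := by
    set φ := Unitary.conjStarAlgAut ℂ _ hG.1.eigenvectorUnitary with hφ
    have e : (Zᴴ * Z).trace • (1 : Matrix m m ℂ) - Zᴴ * Z =
        φ (diagonal fun i => ((∑ j, hG.1.eigenvalues j - hG.1.eigenvalues i : ℝ) : ℂ)) := by
      have : (diagonal fun i => ((∑ j, hG.1.eigenvalues j - hG.1.eigenvalues i : ℝ) : ℂ)) =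
          (Zᴴ * Z).trace • (1 : Matrix m m ℂ) - diagonal (RCLike.ofReal ∘ hG.1.eigenvalues) := by
        rw [hG.1.trace_eq_sum_eigenvalues, smul_one_eq_diagonal, diagonal_sub]
        congr 1
        ext i
        simp
      rw [this, map_sub, map_smul, map_one]
      congr 1
      exact hG.1.spectral_theorem
    rw [e, hφ, Unitary.conjStarAlgAut_apply, star_eq_conjTranspose]
    refine PosSemidef.mul_mul_conjTranspose_same (PosSemidef.diagonal fun i => ?_) _
    have := Finset.single_le_sum (f := hG.1.eigenvalues) (fun j _ => hG.eigenvalues_nonneg j)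
      (Finset.mem_univ i)
    simpa only [Pi.zero_apply, Complex.zero_le_real, sub_nonneg] using this
  refine ⟨(Zᴴ * Z).trace, ?_⟩
  have hW : W = P * Zᴴ := by
    rw [← conjTranspose_conjTranspose W, hZ, conjTranspose_mul, conjTranspose_conjTranspose]
  have e : (Zᴴ * Z).trace • (P * Pᴴ) - W * Wᴴ =
      P * ((Zᴴ * Z).trace • (1 : Matrix m m ℂ) - Zᴴ * Z) * Pᴴ := by
    rw [hZ, hW, Matrix.mul_sub, Matrix.sub_mul, Matrix.mul_smul,
      Matrix.smul_mul, Matrix.mul_one]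
    simp only [Matrix.mul_assoc]
  rw [e]
  exact hdom.mul_mul_conjTranspose_same P

end Kernel

/-! ### Spaces of matrices of rank one -/

section RankOne

variable {m n : Type*} [Fintype n]

theorem exists_eq_vecMulVec_of_rank_le_one [DecidableEq n] {M : Matrix m n ℂ} (h : M.rank ≤ 1) :
    ∃ u v, M = vecMulVec u v := by
  obtain ⟨u, hu⟩ := finrank_le_one_iff.1 h
  have hcol : ∀ j, ∃ c : ℂ, ∀ i, c * (u : m → ℂ) i = M i j := fun j => by
    obtain ⟨c, hc⟩ := hu ⟨M.mulVecLin (Pi.single j 1), LinearMap.mem_range_self _ _⟩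
    exact ⟨c, fun i => by simpa using congrFun (congrArg Subtype.val hc) i⟩
  choose c hc using hcol
  refine ⟨u, c, ?_⟩
  ext i j
  rw [vecMulVec_apply, ← hc, mul_comm]

theorem exists_eq_smul_of_mul_eq_mul {ι : Type*} {u w : ι → ℂ} (hw : w ≠ 0)
    (h : ∀ i k, u i * w k = u k * w i) : ∃ s : ℂ, u = s • w := by
  obtain ⟨k, hk⟩ := Function.ne_iff.1 hw
  refine ⟨u k / w k, funext fun i => ?_⟩
  have hk' : w k ≠ 0 := hk
  simp only [Pi.smul_apply, smul_eq_mul]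
  field_simp
  rw [h i k]

theorem exists_smul_of_rank_add_le_one [DecidableEq n] {u w : m → ℂ} {v z : n → ℂ} (hw : w ≠ 0)
    (hv : v ≠ 0) (h : (vecMulVec u v + vecMulVec w z).rank ≤ 1) :
    (∃ s : ℂ, u = s • w) ∨ ∃ s : ℂ, z = s • v := by
  obtain ⟨x, y, hxy⟩ := exists_eq_vecMulVec_of_rank_le_one h
  have hM : ∀ i j, u i * v j + w i * z j = x i * y j := fun i j => by
    simpa [vecMulVec_apply] using congrFun (congrFun hxy i) j
  -- the `2 × 2` minors of the sum are products of `2 × 2` minors of the factors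
  have hmin : ∀ i k j l, (u i * w k - u k * w i) * (z l * v j - z j * v l) = 0 := by
    intro i k j l
    have : (u i * w k - u k * w i) * (z l * v j - z j * v l) =
        (u i * v j + w i * z j) * (u k * v l + w k * z l) -
          (u i * v l + w i * z l) * (u k * v j + w k * z j) := by ring
    rw [this, hM, hM, hM, hM]
    ring
  by_cases h1 : ∀ i k, u i * w k = u k * w i
  · exact Or.inl (exists_eq_smul_of_mul_eq_mul hw h1)
  · push Not at h1
    obtain ⟨i, k, hik⟩ := h1
    refine Or.inr (exists_eq_smul_of_mul_eq_mul hv fun l j => ?_)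
    exact sub_eq_zero.1 ((mul_eq_zero.1 (hmin i k j l)).resolve_left (sub_ne_zero.2 hik))

/-- A family of matrices all of whose members and pairwise sums have rank at most one has a common
column space or a common row space. -/
theorem common_factor_of_rank_le_one [DecidableEq n] {ι : Type*} {M : ι → Matrix m n ℂ}
    (h1 : ∀ a, (M a).rank ≤ 1) (h2 : ∀ a b, (M a + M b).rank ≤ 1) :
    (∃ u, ∀ a, ∃ v, M a = vecMulVec u v) ∨ ∃ v, ∀ a, ∃ u, M a = vecMulVec u v := by
  by_cases h0 : ∀ a, M a = 0
  · exact Or.inl ⟨0, fun a => ⟨0, by simp [h0 a]⟩⟩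
  push Not at h0
  obtain ⟨a, ha⟩ := h0
  obtain ⟨u, v, huv⟩ := exists_eq_vecMulVec_of_rank_le_one (h1 a)
  have hu : u ≠ 0 := by rintro rfl; exact ha (by rw [huv]; ext; simp [vecMulVec_apply])
  have hv : v ≠ 0 := by rintro rfl; exact ha (by rw [huv]; ext; simp [vecMulVec_apply])
  have key : ∀ c, (∃ z, M c = vecMulVec u z) ∨ ∃ w, M c = vecMulVec w v := by
    intro c
    obtain ⟨w, z, hwz⟩ := exists_eq_vecMulVec_of_rank_le_one (h1 c)
    by_cases hz : z = 0
    · exact Or.inl ⟨0, by rw [hwz, hz]; ext; simp [vecMulVec_apply]⟩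
    have hr := h2 c a
    rw [hwz, huv] at hr
    rcases exists_smul_of_rank_add_le_one hu hz hr with ⟨s, rfl⟩ | ⟨s, hs⟩
    · exact Or.inl ⟨s • z, by rw [hwz, smul_vecMulVec, vecMulVec_smul]⟩
    · have hs0 : s ≠ 0 := by rintro rfl; exact hv (by simpa using hs)
      refine Or.inr ⟨s⁻¹ • w, ?_⟩
      rw [hwz, hs, smul_vecMulVec, vecMulVec_smul, smul_smul, inv_mul_cancel₀ hs0, one_smul]
  by_contra! hcon
  obtain ⟨b, hb⟩ := hcon.1 u
  obtain ⟨c, hc⟩ := hcon.2 v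
  obtain ⟨w, hw⟩ := (key b).resolve_left fun ⟨z, hz⟩ => hb z hz
  obtain ⟨z, hz⟩ := (key c).resolve_right fun ⟨w, hw⟩ => hc w hw
  have hr := h2 b c
  rw [hw, hz] at hr
  rcases exists_smul_of_rank_add_le_one hu hv hr with ⟨s, hs⟩ | ⟨s, hs⟩
  · exact hb (s • v) (by rw [hw, hs, smul_vecMulVec, vecMulVec_smul])
  · exact hc (s • u) (by rw [hz, hs, smul_vecMulVec, vecMulVec_smul])

end RankOne

/-! ### Output and environment of a degradable family -/

section Degrading

variable {A B E : Type*} [Fintype A] [Fintype B] [Fintype E]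

theorem trace_transpose_mul_transpose_conjTranspose (M N : Matrix B E ℂ) :
    (Mᵀ * (Nᵀ)ᴴ).trace = (M * Nᴴ).trace := by
  simp only [trace, diag_apply, mul_apply, transpose_apply, conjTranspose_apply]
  exact Finset.sum_comm

/-- On a pure state, the output and the environment have the same purity. -/
theorem trace_sq_transpose_eq (M : Matrix B E ℂ) :
    ((Mᵀ * (Mᵀ)ᴴ) * (Mᵀ * (Mᵀ)ᴴ)).trace = ((M * Mᴴ) * (M * Mᴴ)).trace := by
  have h : Mᵀ * (Mᵀ)ᴴ = (Mᴴ * M)ᵀ := by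
    rw [transpose_mul]
    rfl
  rw [h, ← transpose_mul, trace_transpose, Matrix.mul_assoc, trace_mul_comm]
  simp only [Matrix.mul_assoc]

theorem conjTranspose_mulVec_eq_zero_of_sum {ι m n : Type*} [Fintype ι] [Fintype m] [Fintype n]
    {K : ι → Matrix m n ℂ} {x : m → ℂ} (h : (∑ a, K a * (K a)ᴴ) *ᵥ x = 0) (a : ι) :
    (K a)ᴴ *ᵥ x = 0 := by
  have h1 : ∑ a, star ((K a)ᴴ *ᵥ x) ⬝ᵥ ((K a)ᴴ *ᵥ x) = 0 := by
    have h2 : star x ⬝ᵥ ((∑ a, K a * (K a)ᴴ) *ᵥ x) = 0 := by rw [h, dotProduct_zero]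
    rw [← h2, Matrix.sum_mulVec, dotProduct_sum]
    refine Finset.sum_congr rfl fun a _ => ?_
    rw [star_mulVec, conjTranspose_conjTranspose, ← dotProduct_mulVec, mulVec_mulVec]
  have h3 := (Finset.sum_eq_zero_iff_of_nonneg fun a _ => dotProduct_star_self_nonneg _).1 h1 a
    (Finset.mem_univ a)
  exact dotProduct_star_self_eq_zero.1 h3

theorem sum_smul_mul_conjTranspose {m n : Type*} [Fintype n] (K : A → Matrix m n ℂ) (ψ : A → ℂ) :
    (∑ a, ψ a • K a) * (∑ a, ψ a • K a)ᴴ =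
      ∑ a, ∑ b, (ψ a * star (ψ b)) • (K a * (K b)ᴴ) := by
  rw [conjTranspose_sum, Matrix.sum_mul]
  refine Finset.sum_congr rfl fun a _ => ?_
  rw [Matrix.mul_sum]
  refine Finset.sum_congr rfl fun b _ => ?_
  rw [conjTranspose_smul, Matrix.smul_mul, Matrix.mul_smul, smul_smul]

variable {K : A → Matrix B E ℂ} {D : SuperOp B E}

/-- Suppose the pure input `ψ` has an output `K_ψ K_ψᴴ` whose rank is that of the output of the
identity. Then a multiple of the former dominates the latter, and applying the degrading map `D`
shows that the environment state of `ψ` has the support of that of the identity. -/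
theorem rank_environment_le_of_rank_output_le [DecidableEq B] [DecidableEq E]
    (hpos : ∀ P : Matrix B B ℂ, P.PosSemidef → (D P).PosSemidef)
    (hD : ∀ a b, D (K a * (K b)ᴴ) = (K a)ᵀ * ((K b)ᵀ)ᴴ) {ψ : A → ℂ}
    (hψ : (∑ a, K a * (K a)ᴴ).rank ≤ (∑ a, ψ a • K a).rank) :
    (∑ a, (K a)ᵀ * ((K a)ᵀ)ᴴ).rank ≤ (∑ a, ψ a • K a).rank := by
  set X := ∑ a, ψ a • K a with hX
  set G := ∑ a, K a * (K a)ᴴ with hG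
  set H := ∑ a, (K a)ᵀ * ((K a)ᵀ)ᴴ with hH
  have hGpos : G.PosSemidef :=
    posSemidef_sum _ fun a _ => posSemidef_self_mul_conjTranspose (K a)
  have hHpos : H.PosSemidef :=
    posSemidef_sum _ fun a _ => posSemidef_self_mul_conjTranspose (K a)ᵀ
  have hle : LinearMap.ker G.mulVecLin ≤ LinearMap.ker Xᴴ.mulVecLin := by
    intro x hx
    have hx' : G *ᵥ x = 0 := by simpa using hx
    have h0 := conjTranspose_mulVec_eq_zero_of_sum hx'
    rw [hX, LinearMap.mem_ker, mulVecLin_apply, conjTranspose_sum, Matrix.sum_mulVec]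
    simp [conjTranspose_smul, smul_mulVec, h0]
  have hker : LinearMap.ker G.mulVecLin = LinearMap.ker Xᴴ.mulVecLin := by
    refine Submodule.eq_of_le_of_finrank_le hle ?_
    have h1 := G.mulVecLin.finrank_range_add_finrank_ker
    have h2 := Xᴴ.mulVecLin.finrank_range_add_finrank_ker
    have h3 : Xᴴ.rank = X.rank := rank_conjTranspose X
    change G.rank + _ = _ at h1
    change Xᴴ.rank + _ = _ at h2
    omega
  obtain ⟨t, ht⟩ := exists_posSemidef_smul_sub hGpos (P := X) fun x hx => by
    have : x ∈ LinearMap.ker G.mulVecLin := by rw [hker]; simpa using hx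
    simpa using this
  have hDX : D (X * Xᴴ) = Xᵀ * (Xᵀ)ᴴ := by
    have hXt : Xᵀ = ∑ a, ψ a • (K a)ᵀ := by simp [hX, transpose_sum, transpose_smul]
    rw [hXt, hX, sum_smul_mul_conjTranspose, sum_smul_mul_conjTranspose]
    simp only [map_sum, map_smul, hD]
  have hDG : D G = H := by simp only [hG, hH, map_sum, hD]
  have hdom := hpos _ ht
  rw [map_sub, map_smul, hDX, hDG] at hdom
  calc H.rank ≤ ((Xᵀ)ᴴ).rank := rank_le_rank_of_ker_le fun x hx => by
        have h1 := hdom.dotProduct_mulVec_nonneg x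
        rw [sub_mulVec, smul_mulVec, ← mulVec_mulVec, hx, mulVec_zero, smul_zero, zero_sub,
          dotProduct_neg, Left.nonneg_neg_iff] at h1
        exact (hHpos.dotProduct_mulVec_zero_iff x).1
          (le_antisymm h1 (hHpos.dotProduct_mulVec_nonneg x))
    _ = X.rank := by rw [rank_conjTranspose, rank_transpose]

/-- If no pure input has an output of rank two, then either all outputs or all environment states
are multiples of one pure state; in the former case the degrading map `D` makes the environment
state constant as well. -/
theorem rank_environment_le_one [DecidableEq A] [DecidableEq E]
    (hD : ∀ a b, D (K a * (K b)ᴴ) = (K a)ᵀ * ((K b)ᵀ)ᴴ)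
    (h : ∀ ψ : A → ℂ, (∑ a, ψ a • K a).rank ≤ 1) :
    (∑ a, (K a)ᵀ * ((K a)ᵀ)ᴴ).rank ≤ 1 := by
  have hsingle : ∀ a, ∑ c, (Pi.single a 1 : A → ℂ) c • K c = K a := fun a => by
    rw [Finset.sum_eq_single a (fun c _ hc => by rw [Pi.single_eq_of_ne hc, zero_smul])
      (fun ha => absurd (Finset.mem_univ a) ha), Pi.single_eq_same, one_smul]
  have h1 : ∀ a, (K a).rank ≤ 1 := fun a => hsingle a ▸ h (Pi.single a 1)
  have h2 : ∀ a b, (K a + K b).rank ≤ 1 := fun a b => by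
    have := h (Pi.single a 1 + Pi.single b 1)
    simp only [Pi.add_apply, add_smul, Finset.sum_add_distrib, hsingle] at this
    exact this
  have hrank : ∀ (c : ℂ) (x y : E → ℂ), (c • vecMulVec x y).rank ≤ 1 := fun c x y => by
    rw [← smul_vecMulVec]
    exact rank_vecMulVec_le _ _
  rcases common_factor_of_rank_le_one h1 h2 with ⟨u, hu⟩ | ⟨v, hv⟩
  · choose v hv using hu
    by_cases h0 : ∀ a, K a = 0
    · simp [h0]
    push Not at h0
    obtain ⟨b, hb⟩ := h0
    have hvb : v b ⬝ᵥ star (v b) ≠ 0 := fun h0 => hb <| by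
      rw [dotProduct_self_star_eq_zero] at h0
      rw [hv b, h0]
      ext
      simp [vecMulVec_apply]
    have hK : ∀ a, K a * (K a)ᴴ = (v a ⬝ᵥ star (v a)) • vecMulVec u (star u) := fun a => by
      rw [hv a, conjTranspose_vecMulVec, vecMulVec_mul_vecMulVec, vecMulVec_smul]
    have hKt : (K b)ᵀ * ((K b)ᵀ)ᴴ = (u ⬝ᵥ star u) • vecMulVec (v b) (star (v b)) := by
      rw [hv b, transpose_vecMulVec, conjTranspose_vecMulVec, vecMulVec_mul_vecMulVec,
        vecMulVec_smul]
    have hu0 : D (vecMulVec u (star u)) =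
        ((v b ⬝ᵥ star (v b))⁻¹ * (u ⬝ᵥ star u)) • vecMulVec (v b) (star (v b)) := by
      rw [mul_smul, ← hKt, ← hD, hK, map_smul, smul_smul, inv_mul_cancel₀ hvb, one_smul]
    have hsum : ∑ a, (K a)ᵀ * ((K a)ᵀ)ᴴ =
        ((∑ a, v a ⬝ᵥ star (v a)) * ((v b ⬝ᵥ star (v b))⁻¹ * (u ⬝ᵥ star u))) •
          vecMulVec (v b) (star (v b)) := by
      simp only [← hD, hK, map_smul, hu0, ← Finset.sum_smul, smul_smul, Finset.sum_mul]
    rw [hsum]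
    exact hrank _ _ _
  · choose u hu using hv
    have hsum : ∑ a, (K a)ᵀ * ((K a)ᵀ)ᴴ =
        (∑ a, u a ⬝ᵥ star (u a)) • vecMulVec v (star v) := by
      rw [Finset.sum_smul]
      refine Finset.sum_congr rfl fun a _ => ?_
      rw [hu a, transpose_vecMulVec, conjTranspose_vecMulVec, vecMulVec_mul_vecMulVec,
        vecMulVec_smul]
    rw [hsum]
    exact hrank _ _ _

theorem rank_environment_le_two [DecidableEq A] [DecidableEq B] [DecidableEq E]
    (hpos : ∀ P : Matrix B B ℂ, P.PosSemidef → (D P).PosSemidef)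
    (hD : ∀ a b, D (K a * (K b)ᴴ) = (K a)ᵀ * ((K b)ᵀ)ᴴ)
    (hr : (∑ a, K a * (K a)ᴴ).rank ≤ 2) :
    (∑ a, (K a)ᵀ * ((K a)ᵀ)ᴴ).rank ≤ 2 := by
  by_cases h : ∃ ψ : A → ℂ, 2 ≤ (∑ a, ψ a • K a).rank
  · obtain ⟨ψ, hψ⟩ := h
    refine (rank_environment_le_of_rank_output_le hpos hD (hr.trans hψ)).trans (le_trans ?_ hr)
    rw [← rank_conjTranspose]
    refine rank_le_rank_of_ker_le fun x hx => ?_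
    have h0 := conjTranspose_mulVec_eq_zero_of_sum hx
    simp [conjTranspose_sum, conjTranspose_smul, Matrix.sum_mulVec, smul_mulVec, h0]
  · push Not at h
    exact (rank_environment_le_one hD fun ψ => Nat.le_of_lt_succ (h ψ)).trans one_le_two

/-- Output and environment have equal purity on each `K a`, and by contractivity of the degrading
map the outputs of `a` and `b` are at least as far apart as their environments in Hilbert-Schmidt
norm. So the overlap of the outputs is at most that of the environments; sum over `a` and `b`. -/
theorem purity_output_le_purity_environment [DecidableEq B] [DecidableEq E]
    (hpos : ∀ P : Matrix B B ℂ, P.PosSemidef → (D P).PosSemidef)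
    (htr : ∀ P, (D P).trace = P.trace)
    (hD : ∀ a b, D (K a * (K b)ᴴ) = (K a)ᵀ * ((K b)ᵀ)ᴴ)
    (hr : (∑ a, K a * (K a)ᴴ).rank ≤ 2) (hK : ∀ a, (K a * (K a)ᴴ).trace = 1) :
    ((∑ a, K a * (K a)ᴴ) * ∑ a, K a * (K a)ᴴ).trace.re ≤
      ((∑ a, (K a)ᵀ * ((K a)ᵀ)ᴴ) * ∑ a, (K a)ᵀ * ((K a)ᵀ)ᴴ).trace.re := by
  simp only [Finset.sum_mul_sum, trace_sum, Complex.re_sum]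
  refine Finset.sum_le_sum fun a _ => Finset.sum_le_sum fun b _ => ?_
  have hherm : ∀ a, (K a * (K a)ᴴ).IsHermitian := fun a => isHermitian_mul_conjTranspose_self _
  have hrank : (K a * (K a)ᴴ - K b * (K b)ᴴ).rank ≤ 2 :=
    (rank_le_rank_of_ker_le fun x hx => by
      have h0 := conjTranspose_mulVec_eq_zero_of_sum hx
      rw [sub_mulVec, ← mulVec_mulVec, ← mulVec_mulVec, h0, h0]
      simp).trans hr
  have h := trace_map_mul_map_self_re_le hpos htr ((hherm a).sub (hherm b))
    (by rw [trace_sub, hK, hK, sub_self]) hrank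
  rw [map_sub, hD, hD, trace_sub_mul_sub_re, trace_sub_mul_sub_re, trace_sq_transpose_eq,
    trace_sq_transpose_eq] at h
  linarith

end Degrading

/-! ### Dilations and the Choi state -/

section Channel

variable {A B E : Type*}

theorem IsChannel.map_posSemidef [Fintype A] [Fintype B] {D : SuperOp A B} (hD : IsChannel D)
    {P : Matrix A A ℂ} (hP : P.PosSemidef) : (D P).PosSemidef := by
  have h := hD.completelyPositive 1 (P.submatrix Prod.snd Prod.snd) (hP.submatrix _)
  exact h.submatrix fun b => ((0 : Fin 1), b)

/-- The pure output `V |a⟩` on `ℂ^B ⊗ ℂ^E` of a basis vector, reshaped into a `B × E` matrix `K a`,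
so that `K a * (K b)ᴴ` and `(K a)ᵀ * ((K b)ᵀ)ᴴ` are the two partial traces of `V |a⟩⟨b| V†`. -/
def outputMatrix (V : Matrix (B × E) A ℂ) (a : A) : Matrix B E ℂ :=
  Matrix.of fun b e => V (b, e) a

variable [Fintype A]

theorem card_inv_ne_zero [Nonempty A] : ((Fintype.card A : ℂ)⁻¹) ≠ 0 :=
  inv_ne_zero (Nat.cast_ne_zero.2 Fintype.card_ne_zero)

theorem rank_smul_of_ne_zero {m n : Type*} [Fintype n] {c : ℂ} (hc : c ≠ 0)
    (M : Matrix m n ℂ) : (c • M).rank = M.rank :=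
  rank_smul_of_mem_nonZeroDivisors M (mem_nonZeroDivisors_of_ne_zero hc)

theorem card_inv_eq_ofReal : (Fintype.card A : ℂ)⁻¹ = (((Fintype.card A : ℝ)⁻¹ : ℝ) : ℂ) := by
  simp

theorem card_inv_nonneg : 0 ≤ (Fintype.card A : ℂ)⁻¹ := by
  rw [card_inv_eq_ofReal, Complex.zero_le_real]
  positivity

theorem trace_smul_mul_smul_re {n : Type*} [Fintype n] (r : ℝ) (M : Matrix n n ℂ) :
    (((r : ℂ) • M) * ((r : ℂ) • M)).trace.re = r ^ 2 * (M * M).trace.re := by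
  rw [Matrix.smul_mul, Matrix.mul_smul, smul_smul, trace_smul, smul_eq_mul,
    ← Complex.ofReal_mul, Complex.re_ofReal_mul, sq]

theorem trace_traceFst [Fintype B] (M : Matrix (A × B) (A × B) ℂ) :
    (traceFst M).trace = M.trace := by
  simp only [trace, diag_apply, Fintype.sum_prod_type]
  exact Finset.sum_comm

variable [DecidableEq A]

theorem mul_single_mul_conjTranspose_apply {X : Type*} (V : Matrix X A ℂ) (a a' : A) (p q : X) :
    (V * single a a' (1 : ℂ) * Vᴴ) p q = V p a * star (V q a') := by
  rw [mul_apply, Finset.sum_eq_single a']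
  · rw [mul_single_apply_same, mul_one, conjTranspose_apply]
  · intro c _ hc
    rw [mul_single_apply_of_ne _ _ _ _ _ hc, zero_mul]
  · simp

theorem traceSnd_single [Fintype E] (V : Matrix (B × E) A ℂ) (a a' : A) :
    traceSnd (V * single a a' (1 : ℂ) * Vᴴ) = outputMatrix V a * (outputMatrix V a')ᴴ := by
  ext b b'
  change ∑ e, (V * single a a' (1 : ℂ) * Vᴴ) (b, e) (b', e) = _
  simp only [mul_single_mul_conjTranspose_apply]
  rfl

theorem traceFst_single [Fintype B] (V : Matrix (B × E) A ℂ) (a a' : A) :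
    traceFst (V * single a a' (1 : ℂ) * Vᴴ) = (outputMatrix V a)ᵀ * ((outputMatrix V a')ᵀ)ᴴ := by
  ext e e'
  change ∑ b, (V * single a a' (1 : ℂ) * Vᴴ) (b, e) (b, e') = _
  simp only [mul_single_mul_conjTranspose_apply]
  rfl

theorem ext_single {N M : SuperOp A B} (h : ∀ a a', N (single a a' 1) = M (single a a' 1)) :
    N = M :=
  Matrix.ext_linearMap ℂ fun a a' => LinearMap.ext_ring (h a a')

theorem choi_apply (N : SuperOp A B) (a a' : A) (b b' : B) :
    choi N (a, b) (a', b') = (Fintype.card A : ℂ)⁻¹ * N (single a a' 1) b b' := by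
  have h : choi N (a, b) (a', b') = (Fintype.card A : ℂ)⁻¹ *
      ∑ c, ∑ c', single c c' (1 : ℂ) a a' * N (single c c' 1) b b' := by
    simp only [choi, Matrix.smul_apply, Matrix.sum_apply, smul_eq_mul]
    rfl
  rw [h, Finset.sum_eq_single a, Finset.sum_eq_single a']
  · simp
  · intro c _ hc
    rw [single_apply_of_col_ne _ _ hc, zero_mul]
  · simp
  · intro c _ hc
    refine Finset.sum_eq_zero fun c' _ => ?_
    rw [single_apply_of_row_ne hc, zero_mul]
  · simp

theorem traceFst_choi (N : SuperOp A B) :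
    traceFst (choi N) = (Fintype.card A : ℂ)⁻¹ • ∑ a, N (single a a 1) := by
  ext b b'
  change ∑ a, choi N (a, b) (a, b') = _
  simp only [choi_apply, Matrix.smul_apply, Matrix.sum_apply, Finset.mul_sum, smul_eq_mul]

section Dilation

variable [Fintype B] [Fintype E] {N : SuperOp A B} {V : Matrix (B × E) A ℂ}

theorem IsDilation.map_single (hV : IsDilation V N) (a a' : A) :
    N (single a a' 1) = outputMatrix V a * (outputMatrix V a')ᴴ := by
  rw [hV.2, traceSnd_single]

theorem IsDilation.trace_outputMatrix (hV : IsDilation V N) (a a' : A) :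
    (outputMatrix V a * (outputMatrix V a')ᴴ).trace = (1 : Matrix A A ℂ) a' a := by
  rw [← hV.1, mul_apply, Fintype.sum_prod_type]
  simp only [trace, diag_apply, mul_apply, conjTranspose_apply, outputMatrix, of_apply]
  exact Finset.sum_congr rfl fun b _ => Finset.sum_congr rfl fun e _ => mul_comm _ _

/-- The purification of the unnormalized Choi matrix given by `V`, as a matrix from the environment
`ℂ^E` to `ℂ^A ⊗ ℂ^B`. -/
def choiFactor (V : Matrix (B × E) A ℂ) : Matrix (A × B) E ℂ :=
  Matrix.of fun p e => V (p.2, e) p.1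

theorem IsDilation.choi_eq (hV : IsDilation V N) :
    choi N = (Fintype.card A : ℂ)⁻¹ • (choiFactor V * (choiFactor V)ᴴ) := by
  ext ⟨a, b⟩ ⟨a', b'⟩
  rw [choi_apply, hV.map_single]
  rfl

omit [DecidableEq A] [Fintype E] in
theorem conjTranspose_choiFactor_mul_self (V : Matrix (B × E) A ℂ) :
    (choiFactor V)ᴴ * choiFactor V = (∑ a, (outputMatrix V a)ᵀ * ((outputMatrix V a)ᵀ)ᴴ)ᵀ := by
  ext e e'
  rw [mul_apply, Fintype.sum_prod_type, transpose_apply, Matrix.sum_apply]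
  exact Finset.sum_congr rfl fun a _ => Finset.sum_congr rfl fun b _ => mul_comm _ _

theorem IsDilation.rank_choi [Nonempty A] (hV : IsDilation V N) :
    (choi N).rank = (∑ a, (outputMatrix V a)ᵀ * ((outputMatrix V a)ᵀ)ᴴ).rank := by
  rw [hV.choi_eq, rank_smul_of_ne_zero card_inv_ne_zero, rank_self_mul_conjTranspose,
    ← rank_conjTranspose_mul_self, conjTranspose_choiFactor_mul_self, rank_transpose]

theorem IsDilation.rank_choi_le_card [Nonempty A] (hV : IsDilation V N) :
    (choi N).rank ≤ Fintype.card E := by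
  rw [hV.choi_eq, rank_smul_of_ne_zero card_inv_ne_zero, rank_self_mul_conjTranspose]
  exact rank_le_card_width _

/-- The Choi state and the environment of the maximally mixed state are the two marginals of a
pure state, hence have the same purity. -/
theorem IsDilation.purity_choi (hV : IsDilation V N) :
    (choi N * choi N).trace.re = ((Fintype.card A : ℝ)⁻¹) ^ 2 *
      ((∑ a, (outputMatrix V a)ᵀ * ((outputMatrix V a)ᵀ)ᴴ) *
        ∑ a, (outputMatrix V a)ᵀ * ((outputMatrix V a)ᵀ)ᴴ).trace.re := by
  have h : ((choiFactor V * (choiFactor V)ᴴ) * (choiFactor V * (choiFactor V)ᴴ)).trace =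
      (((choiFactor V)ᴴ * choiFactor V) * ((choiFactor V)ᴴ * choiFactor V)).trace := by
    rw [Matrix.mul_assoc, trace_mul_comm]
    simp only [Matrix.mul_assoc]
  rw [hV.choi_eq, card_inv_eq_ofReal, trace_smul_mul_smul_re, h,
    conjTranspose_choiFactor_mul_self, ← transpose_mul, trace_transpose]

theorem IsDilation.purity_traceFst_choi (hV : IsDilation V N) :
    (traceFst (choi N) * traceFst (choi N)).trace.re = ((Fintype.card A : ℝ)⁻¹) ^ 2 *
      ((∑ a, outputMatrix V a * (outputMatrix V a)ᴴ) *
        ∑ a, outputMatrix V a * (outputMatrix V a)ᴴ).trace.re := by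
  rw [traceFst_choi, card_inv_eq_ofReal, trace_smul_mul_smul_re]
  simp only [hV.map_single]

theorem IsDilation.rank_traceFst_choi [Nonempty A] (hV : IsDilation V N) :
    (traceFst (choi N)).rank = (∑ a, outputMatrix V a * (outputMatrix V a)ᴴ).rank := by
  rw [traceFst_choi, rank_smul_of_ne_zero card_inv_ne_zero]
  simp only [hV.map_single]

theorem IsDilation.posSemidef_choi (hV : IsDilation V N) : (choi N).PosSemidef := by
  rw [hV.choi_eq]
  exact (posSemidef_self_mul_conjTranspose _).smul card_inv_nonneg

theorem IsDilation.posSemidef_traceFst_choi (hV : IsDilation V N) :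
    (traceFst (choi N)).PosSemidef := by
  rw [traceFst_choi]
  refine PosSemidef.smul (posSemidef_sum _ fun a _ => ?_) card_inv_nonneg
  rw [hV.map_single]
  exact posSemidef_self_mul_conjTranspose _

theorem IsDilation.trace_traceFst_choi [Nonempty A] (hV : IsDilation V N) :
    (traceFst (choi N)).trace = 1 := by
  have : (Fintype.card A : ℂ) ≠ 0 := Nat.cast_ne_zero.2 Fintype.card_ne_zero
  simp [traceFst_choi, trace_smul, trace_sum, hV.map_single, hV.trace_outputMatrix, this]

theorem IsDilation.trace_choi [Nonempty A] (hV : IsDilation V N) : (choi N).trace = 1 := by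
  rw [← trace_traceFst, hV.trace_traceFst_choi]

/-- A factorization of the Choi matrix through `ℂ^k` is a dilation with environment `ℂ^k`. -/
theorem IsChannel.hasEnvironment_of_rank_choi_le [Nonempty A] [DecidableEq B]
    (hN : IsChannel N) (hC : (choi N).PosSemidef) {k : ℕ} (hk : (choi N).rank ≤ k) :
    HasEnvironment N k := by
  have hcard : (0 : ℂ) ≤ Fintype.card A := Nat.cast_nonneg _
  have hcard0 : (Fintype.card A : ℂ) ≠ 0 := Nat.cast_ne_zero.2 Fintype.card_ne_zero
  obtain ⟨W, hW⟩ := exists_eq_mul_conjTranspose_of_rank_le (hC.smul hcard)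
    ((rank_smul_of_ne_zero hcard0 _).le.trans hk)
  let V : Matrix (B × Fin k) A ℂ := Matrix.of fun p a => W (a, p.1) p.2
  have hNV : ∀ a a', N (single a a' 1) = outputMatrix V a * (outputMatrix V a')ᴴ := by
    intro a a'
    ext b b'
    have h := congrFun (congrFun hW (a, b)) (a', b')
    rw [Matrix.smul_apply, choi_apply, smul_eq_mul, mul_inv_cancel_left₀ hcard0] at h
    rw [h]
    rfl
  refine ⟨V, ?_, ?_⟩
  · ext a' a
    have h := hN.tracePreserving (single a a' 1)
    rw [hNV] at h
    have h1 : (single a a' (1 : ℂ)).trace = (1 : Matrix A A ℂ) a' a := by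
      by_cases hab : a = a'
      · subst hab; simp
      · rw [trace_single_eq_of_ne _ _ _ hab, one_apply_ne (Ne.symm hab)]
    rw [← h1, ← h, mul_apply, Fintype.sum_prod_type]
    simp only [trace, diag_apply, mul_apply, conjTranspose_apply, outputMatrix, of_apply]
    exact Finset.sum_congr rfl fun b _ => Finset.sum_congr rfl fun e _ => mul_comm _ _
  · let M : SuperOp A B := traceSnd ∘ₗ
      ((mulRightLinearMap (B × Fin k) ℂ Vᴴ) ∘ₗ (mulLeftLinearMap A ℂ V))
    have hM : N = M := ext_single fun a a' => by
      rw [hNV]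
      exact (traceSnd_single V a a').symm
    exact fun ρ => LinearMap.congr_fun hM ρ

end Dilation

end Channel

/-! ### Degradable and anti-degradable channels -/

/-- A degradable channel with qubit output: the environment has rank at most two and is at least
as pure as the output. -/
theorem IsDegradable.envDim_le_two_and_lambdaMax_le {A : Type*} [Fintype A] [DecidableEq A]
    [Nonempty A] {N : SuperOp A (Fin 2)} (hN : IsChannel N) (hdeg : IsDegradable N) :
    envDim N ≤ 2 ∧ lambdaMax (traceFst (choi N)) ≤ lambdaMax (choi N) := by
  obtain ⟨d, NC, ⟨V, hV, hNC⟩, D, hD, rfl⟩ := hdeg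
  have hDK : ∀ a b, D (outputMatrix V a * (outputMatrix V b)ᴴ) =
      (outputMatrix V a)ᵀ * ((outputMatrix V b)ᵀ)ᴴ :=
    fun a b => by
      rw [← traceFst_single, ← hNC, LinearMap.comp_apply, hV.map_single]
  have hpos : ∀ P, P.PosSemidef → (D P).PosSemidef := fun _ => hD.map_posSemidef
  have hr : (∑ a, outputMatrix V a * (outputMatrix V a)ᴴ).rank ≤ 2 :=
    (rank_le_card_width _).trans (Fintype.card_fin 2).le
  refine ⟨?_, ?_⟩
  · have h := rank_environment_le_two hpos hDK hr
    rw [← hV.rank_choi] at h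
    exact iInf₂_le 2 (hN.hasEnvironment_of_rank_choi_le hV.posSemidef_choi h)
  · refine lambdaMax_le_lambdaMax_of_purity_le hV.posSemidef_traceFst_choi hV.posSemidef_choi
      hV.trace_traceFst_choi hV.trace_choi (hV.rank_traceFst_choi.le.trans hr) ?_
    rw [hV.purity_choi, hV.purity_traceFst_choi]
    have h := purity_output_le_purity_environment hpos hD.tracePreserving hDK hr
      fun a => by rw [hV.trace_outputMatrix, one_apply_eq]
    gcongr

/-- For an anti-degradable channel the output and the environment exchange their roles: the
output matrices are transposed. -/
theorem IsAntiDegradable.rank_le_two_and_lambdaMax_le {A B : Type*} [Fintype A] [DecidableEq A]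
    [Nonempty A] [Fintype B] [DecidableEq B] {N : SuperOp A B} (hdeg : IsAntiDegradable N)
    (henv : HasEnvironment N 2) :
    (traceFst (choi N)).rank ≤ 2 ∧ lambdaMax (choi N) ≤ lambdaMax (traceFst (choi N)) := by
  obtain ⟨V₂, hV₂⟩ := henv
  have hrank : (choi N).rank ≤ 2 := hV₂.rank_choi_le_card.trans (Fintype.card_fin 2).le
  obtain ⟨d, NC, ⟨V, hV, hNC⟩, D, hD, hND⟩ := hdeg
  have hDK : ∀ a b, D ((outputMatrix V a)ᵀ * ((outputMatrix V b)ᵀ)ᴴ) =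
      ((outputMatrix V a)ᵀ)ᵀ * (((outputMatrix V b)ᵀ)ᵀ)ᴴ := fun a b => by
    rw [transpose_transpose, transpose_transpose, ← hV.map_single, hND, LinearMap.comp_apply, hNC,
      traceFst_single]
  have hpos : ∀ P, P.PosSemidef → (D P).PosSemidef := fun _ => hD.map_posSemidef
  have hr : (∑ a, (outputMatrix V a)ᵀ * ((outputMatrix V a)ᵀ)ᴴ).rank ≤ 2 := hV.rank_choi ▸ hrank
  have h1 := rank_environment_le_two hpos hDK hr
  have h2 := purity_output_le_purity_environment hpos hD.tracePreserving hDK hr fun a => by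
    rw [trace_transpose_mul_transpose_conjTranspose, hV.trace_outputMatrix, one_apply_eq]
  simp only [transpose_transpose] at h1 h2
  refine ⟨hV.rank_traceFst_choi.le.trans h1, ?_⟩
  refine lambdaMax_le_lambdaMax_of_purity_le hV.posSemidef_choi hV.posSemidef_traceFst_choi
    hV.trace_choi hV.trace_traceFst_choi hrank ?_
  rw [hV.purity_choi, hV.purity_traceFst_choi]
  gcongr

end QuantumChannel

theorem corollary4 :
    (∀ {A : Type*} [Fintype A] [DecidableEq A] [Nonempty A] (N : SuperOp A (Fin 2)),
      IsChannel N → IsDegradable N →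
        envDim N ≤ 2 ∧ lambdaMax (traceFst (choi N)) ≤ lambdaMax (choi N)) ∧
    (∀ {A B : Type*} [Fintype A] [DecidableEq A] [Nonempty A] [Fintype B] [DecidableEq B]
      (N : SuperOp A B),
      IsChannel N → IsAntiDegradable N → HasEnvironment N 2 →
        (traceFst (choi N)).rank ≤ 2 ∧
          lambdaMax (choi N) ≤ lambdaMax (traceFst (choi N))) :=
  ⟨fun _ hN hdeg => hdeg.envDim_le_two_and_lambdaMax_le hN,
    fun _ _ hdeg henv => hdeg.rank_le_two_and_lambdaMax_le henv⟩
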